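/- Let $S\subset\mathbb{R}^3$ be a surface. A point $p\in S$ is umbilic if the two principal curvatures of $S$ at $p$ coincide. At an umbilic point $p$, choose a positive orthonormal frame $(e_0,e_1,e_2)$ such that $S$ is given near $p$ by $(x,y)\mapsto p+xe_0+ye_1+h(x,y)e_2$ with $$h(x,y)=\frac k2(x^2+y^2)+\frac a6x^3+\frac b2xy^2+\frac c6y^3+O\big((x^2+y^2)^2\big)$$ (by a rotation of the $x,y$-axes the $x^2y$ term can always be removed). The point $p$ is of type $D_1$ for the principal curvature lines if, for such a chart, $b(b-a)\neq0$ and $$\Delta_P=4b(a-2b)^3-c^2(a-2b)^2>0,$$ and it is of type $H_1$ for the harmonic mean curvature lines (the curves along which the normal curvature equals $\mathcal K/\mathcal H$, with $\mathcal K$ the Gaussian and $\mathcal H$ the arithmetic mean curvature) if, for such a chart, $kb(b-a)\neq0$ and $$\Delta_h=4c^2(2a-b)^2-\big[3c^2+(a-5b)^2\big]\big[3(a-5b)(a-b)+c^2\big]>0.$$ Proposition 8. Let $a>b>c>0$ be real numbers (unrelated to the coefficients above) and let $\mathbb E_{a,b,c}=\{(x,y,z)\in\mathbb{R}^3:\ x^2/a^2+y^2/b^2+z^2/c^2=1\}$.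 Then $\mathbb E_{a,b,c}$ has exactly four umbilic points, all of them lie in the plane $y=0$ of symmetry orthogonal to the middle axis, and each of them is of type $H_1$ for the harmonic mean curvature lines and of type $D_1$ for the principal curvature lines. -/

import Mathlib

open scoped Topology

noncomputable section

/-- Euclidean three-space. -/
abbrev E3 : Type := EuclideanSpace ℝ (Fin 3)

/-- The cross product of Euclidean three-space with its standard orientation. -/
def cross3 (v w : E3) : E3 :=
  WithLp.toLp 2 (crossProduct (WithLp.ofLp v) (WithLp.ofLp w))

/-- `X`, restricted to the open set `U` of the plane, is a regular local parametrization of the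
surface `S`: an immersion of class `C^4` which is a homeomorphism of `U` onto a relatively open
subset of `S`. -/
structure IsLocalParametrization (S : Set E3) (X : ℝ × ℝ → E3) (U : Set (ℝ × ℝ)) : Prop where
  isOpen : IsOpen U
  contDiffOn : ContDiffOn ℝ 4 X U
  immersion : ∀ q ∈ U, Function.Injective (fderiv ℝ X q)
  isEmbedding : Topology.IsEmbedding (fun q : U => X q)
  image_eq : ∃ V : Set E3, IsOpen V ∧ X '' U = S ∩ V

/-- The unit normal `N = X_u × X_v / |X_u × X_v|`, so that `(X_u, X_v, N)` is a positive frame. -/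
def unitNormal (X : ℝ × ℝ → E3) (q : ℝ × ℝ) : E3 :=
  ‖cross3 (fderiv ℝ X q (1, 0)) (fderiv ℝ X q (0, 1))‖⁻¹ •
    cross3 (fderiv ℝ X q (1, 0)) (fderiv ℝ X q (0, 1))

/-- The first fundamental form `I = ⟨DX, DX⟩`, as a bilinear form. -/
def firstForm (X : ℝ × ℝ → E3) (q s t : ℝ × ℝ) : ℝ :=
  inner ℝ (fderiv ℝ X q s) (fderiv ℝ X q t)

/-- The second fundamental form `II = ⟨N, D²X⟩`, as a bilinear form. -/
def secondForm (X : ℝ × ℝ → E3) (q s t : ℝ × ℝ) : ℝ :=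
  inner ℝ (unitNormal X q) (fderiv ℝ (fderiv ℝ X) q s t)

/-- `κ` is a principal curvature of `X` at `q`: an eigenvalue of the second fundamental form
with respect to the first one. -/
def IsPrincipalCurvature (X : ℝ × ℝ → E3) (q : ℝ × ℝ) (κ : ℝ) : Prop :=
  ∃ t : ℝ × ℝ, t ≠ 0 ∧ ∀ s : ℝ × ℝ, secondForm X q t s = κ * firstForm X q t s

/-- `p` is an umbilic point of the surface `S`: the two principal curvatures at `p` coincide. -/
def IsUmbilic (S : Set E3) (p : E3) : Prop :=
  ∃ (X : ℝ × ℝ → E3) (U : Set (ℝ × ℝ)), IsLocalParametrization S X U ∧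
    ∃ q ∈ U, X q = p ∧ ∃! κ : ℝ, IsPrincipalCurvature X q κ

/-- In a Monge chart `(x, y) ↦ p + x e₀ + y e₁ + h(x, y) e₂` of `S` at `p`, where `(e₀, e₁, e₂)` is
a positive orthonormal frame, one has
`h(x, y) = (k/2)(x² + y²) + (a/6) x³ + (b/2) x y² + (c/6) y³ + O(4)`. -/
def HasReducedMongeChart (S : Set E3) (p : E3) (k a b c : ℝ) : Prop :=
  ∃ (e : OrthonormalBasis (Fin 3) ℝ E3) (h : ℝ × ℝ → ℝ) (U : Set (ℝ × ℝ)),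
    cross3 (e 0) (e 1) = e 2 ∧ (0 : ℝ × ℝ) ∈ U ∧
    IsLocalParametrization S (fun q => p + q.1 • e 0 + q.2 • e 1 + h q • e 2) U ∧
    (fun q : ℝ × ℝ => h q - (k / 2 * (q.1 ^ 2 + q.2 ^ 2) + a / 6 * q.1 ^ 3
      + b / 2 * (q.1 * q.2 ^ 2) + c / 6 * q.2 ^ 3)) =O[𝓝 0] (fun q : ℝ × ℝ => ‖q‖ ^ 4)

/-- The umbilic point `p` of `S` is of type `D₁` for the principal curvature lines:
`b (b - a) ≠ 0` and `Δ_P > 0` in a reduced Monge chart. -/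
def IsTypeD1 (S : Set E3) (p : E3) : Prop :=
  IsUmbilic S p ∧ ∃ k a b c : ℝ, HasReducedMongeChart S p k a b c ∧
    b * (b - a) ≠ 0 ∧
    0 < 4 * b * (a - 2 * b) ^ 3 - c ^ 2 * (a - 2 * b) ^ 2

/-- The umbilic point `p` of `S` is of type `H₁` for the harmonic mean curvature lines:
`k b (b - a) ≠ 0` and `Δ_h > 0` in a reduced Monge chart. -/
def IsTypeH1 (S : Set E3) (p : E3) : Prop :=
  IsUmbilic S p ∧ ∃ k a b c : ℝ, HasReducedMongeChart S p k a b c ∧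
    k * b * (b - a) ≠ 0 ∧
    0 < 4 * c ^ 2 * (2 * a - b) ^ 2
      - (3 * c ^ 2 + (a - 5 * b) ^ 2) * (3 * (a - 5 * b) * (a - b) + c ^ 2)

/-- The ellipsoid with semi-axes `a`, `b`, `c` along the coordinate axes. -/
def ellipsoid (a b c : ℝ) : Set E3 :=
  {p | p 0 ^ 2 / a ^ 2 + p 1 ^ 2 / b ^ 2 + p 2 ^ 2 / c ^ 2 = 1}

end

/-! The ellipsoid is `⟨T p, p⟩ = 1` with `T` diagonal, of entries `d 0 < d 1 < d 2`. Differentiating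
twice along a chart shows that `T p` is normal and that the second fundamental form is a nonzero
multiple of `⟨T ·, ·⟩` on the tangent plane (`secondForm_of_quadric`). So `p` is umbilic iff `T` is
scalar, as a form, on `(T p)ᗮ`. This forces the scalar `d 1`, `p 1 = 0` and one quadratic relation
between `p 0` and `p 2` (`scalar_on_orthogonal_iff`); together with the equation of the ellipsoid
this leaves four points.

At such a point, take `e 1` along the middle axis and `e 2` the inward normal. The surface becomes
`α (x² + y²) + 2γxw + δw² = 2gw`, whose small root is `w = (α/2g)(x² + y²) + (γα/2g²) x(x² + y²) +
O(4)` (`mongeRoot_isBigO`). Hence the cubic coefficients are `(3B, B, 0)` with `B = γα/g² ≠ 0`, and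
the two discriminants are `Δ_h = 48 B⁴` and `Δ_P = 4 B⁴`. -/

/-! ### Diagonal operators and the cross product -/

/-- The diagonal operator of Euclidean three-space with entries `d`. -/
noncomputable def diagMap (d : Fin 3 → ℝ) : E3 →L[ℝ] E3 :=
  LinearMap.toContinuousLinearMap
    { toFun := fun v => WithLp.toLp 2 (fun i => d i * v i)
      map_add' := fun v w => by ext i; simp [mul_add]
      map_smul' := fun r v => by ext i; simp [mul_left_comm] }

@[simp] lemma diagMap_apply (d : Fin 3 → ℝ) (v : E3) (i : Fin 3) :
    diagMap d v i = d i * v i := rfl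

lemma inner_E3 (v w : E3) : inner ℝ v w = v 0 * w 0 + v 1 * w 1 + v 2 * w 2 := by
  simp [PiLp.inner_apply, Fin.sum_univ_three]; ring

lemma inner_diagMap (d : Fin 3 → ℝ) (v w : E3) :
    inner ℝ (diagMap d v) w = d 0 * v 0 * w 0 + d 1 * v 1 * w 1 + d 2 * v 2 * w 2 := by
  simp [inner_E3]

lemma diagMap_isSymmetric (d : Fin 3 → ℝ) : (diagMap d : E3 →ₗ[ℝ] E3).IsSymmetric := by
  intro v w
  change inner ℝ (diagMap d v) w = inner ℝ v (diagMap d w)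
  rw [inner_diagMap, inner_E3]; simp; ring

lemma inner_cross3_left (v w : E3) : inner ℝ (cross3 v w) v = 0 := by
  rw [inner_E3]; simp [cross3, cross_apply]; ring

lemma inner_cross3_right (v w : E3) : inner ℝ (cross3 v w) w = 0 := by
  rw [inner_E3]; simp [cross3, cross_apply]; ring

lemma cross3_ne_zero {v w : E3} (h : LinearIndependent ℝ ![v, w]) : cross3 v w ≠ 0 := by
  intro h0
  have h1 : crossProduct (WithLp.ofLp v) (WithLp.ofLp w) = 0 := by
    simpa [cross3] using h0
  have h2 := h.map' (WithLp.linearEquiv 2 ℝ (Fin 3 → ℝ)).toLinearMap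
    (LinearEquiv.ker _)
  refine (crossProduct_ne_zero_iff_linearIndependent).2 ?_ h1
  have e : ![WithLp.ofLp v, WithLp.ofLp w] =
      (WithLp.linearEquiv 2 ℝ (Fin 3 → ℝ)).toLinearMap ∘ ![v, w] := by
    ext i; fin_cases i <;> rfl
  rw [e]
  exact h2

/-! ### Curvature of a central quadric -/

section Quadric

variable {S : Set E3} {X : ℝ × ℝ → E3} {U : Set (ℝ × ℝ)} {T : E3 →L[ℝ] E3} {q : ℝ × ℝ}

lemma IsLocalParametrization.mem (hX : IsLocalParametrization S X U) (hq : q ∈ U) : X q ∈ S := by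
  obtain ⟨V, -, hV⟩ := hX.image_eq
  exact (hV ▸ Set.mem_image_of_mem X hq : X q ∈ S ∩ V).1

lemma IsLocalParametrization.contDiffAt (hX : IsLocalParametrization S X U) (hq : q ∈ U) :
    ContDiffAt ℝ 4 X q :=
  hX.contDiffOn.contDiffAt (hX.isOpen.mem_nhds hq)

lemma inner_fderiv_eq_zero_of_quadric (hT : (T : E3 →ₗ[ℝ] E3).IsSymmetric)
    (hS : ∀ p ∈ S, inner ℝ (T p) p = 1) (hX : IsLocalParametrization S X U) (hq : q ∈ U)
    (s : ℝ × ℝ) : inner ℝ (T (X q)) (fderiv ℝ X q s) = 0 := by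
  have hd : HasFDerivAt X (fderiv ℝ X q) q :=
    ((hX.contDiffAt hq).differentiableAt (by norm_num)).hasFDerivAt
  have h1 := (T.hasFDerivAt.comp q hd).inner ℝ hd
  have h2 : (fun z => inner ℝ ((T ∘ X) z) (X z)) =ᶠ[𝓝 q] fun _ => (1 : ℝ) := by
    filter_upwards [hX.isOpen.mem_nhds hq] with z hz using hS _ (hX.mem hz)
  have h3 := DFunLike.congr_fun (h1.unique ((hasFDerivAt_const (1 : ℝ) q).congr_of_eventuallyEq h2)) s
  have h4 : inner ℝ (T (fderiv ℝ X q s)) (X q) = inner ℝ (fderiv ℝ X q s) (T (X q)) := hT _ _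
  simp [fderivInnerCLM_apply, h4] at h3
  rw [real_inner_comm (T (X q))] at h3
  linarith

/-- Differentiating the tangency identity trades the second derivative of the chart for `T` on
tangent vectors. -/
lemma inner_fderiv_fderiv_of_quadric (hT : (T : E3 →ₗ[ℝ] E3).IsSymmetric)
    (hS : ∀ p ∈ S, inner ℝ (T p) p = 1) (hX : IsLocalParametrization S X U) (hq : q ∈ U)
    (s t : ℝ × ℝ) : inner ℝ (T (X q)) (fderiv ℝ (fderiv ℝ X) q s t) =
      - inner ℝ (T (fderiv ℝ X q s)) (fderiv ℝ X q t) := by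
  have hd : HasFDerivAt X (fderiv ℝ X q) q :=
    ((hX.contDiffAt hq).differentiableAt (by norm_num)).hasFDerivAt
  have hd2 : HasFDerivAt (fderiv ℝ X) (fderiv ℝ (fderiv ℝ X) q) q :=
    (((hX.contDiffAt hq).fderiv_right (m := 3) (by norm_num)).differentiableAt
      (by norm_num)).hasFDerivAt
  have hd3 := hd2.clm_apply (hasFDerivAt_const t q)
  have h1 := (T.hasFDerivAt.comp q hd).inner ℝ hd3
  have h2 : (fun z => inner ℝ ((T ∘ X) z) (fderiv ℝ X z t)) =ᶠ[𝓝 q] fun _ => (0 : ℝ) := by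
    filter_upwards [hX.isOpen.mem_nhds hq] with z hz using
      inner_fderiv_eq_zero_of_quadric hT hS hX hz t
  have h3 := DFunLike.congr_fun (h1.unique ((hasFDerivAt_const (0 : ℝ) q).congr_of_eventuallyEq h2)) s
  simp [fderivInnerCLM_apply] at h3
  linarith

lemma range_fderiv_of_quadric (hT : (T : E3 →ₗ[ℝ] E3).IsSymmetric)
    (hS : ∀ p ∈ S, inner ℝ (T p) p = 1) (hX : IsLocalParametrization S X U) (hq : q ∈ U) :
    (fderiv ℝ X q : ℝ × ℝ →ₗ[ℝ] E3).range = (ℝ ∙ T (X q))ᗮ := by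
  have h0 : T (X q) ≠ 0 := fun h => by simpa [h] using hS _ (hX.mem hq)
  apply Submodule.eq_of_le_of_finrank_eq
  · rintro _ ⟨s, rfl⟩
    exact Submodule.mem_orthogonal_singleton_iff_inner_right.2
      (inner_fderiv_eq_zero_of_quadric hT hS hX hq s)
  · rw [LinearMap.finrank_range_of_inj (hX.immersion q hq)]
    have : Fact (Module.finrank ℝ E3 = 2 + 1) := ⟨by simp⟩
    rw [Submodule.finrank_orthogonal_span_singleton (n := 2) h0]
    simp

lemma exists_fderiv_eq_of_quadric (hT : (T : E3 →ₗ[ℝ] E3).IsSymmetric)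
    (hS : ∀ p ∈ S, inner ℝ (T p) p = 1) (hX : IsLocalParametrization S X U) (hq : q ∈ U)
    {v : E3} (hv : inner ℝ (T (X q)) v = 0) : ∃ s, fderiv ℝ X q s = v := by
  have := (range_fderiv_of_quadric hT hS hX hq).symm ▸
    Submodule.mem_orthogonal_singleton_iff_inner_right.2 hv
  exact this

/-- Both vectors span the normal line. The sign of `r` depends on the orientation of the chart; only
`r ≠ 0` matters for umbilicity. -/
lemma unitNormal_of_quadric (hT : (T : E3 →ₗ[ℝ] E3).IsSymmetric)
    (hS : ∀ p ∈ S, inner ℝ (T p) p = 1) (hX : IsLocalParametrization S X U) (hq : q ∈ U) :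
    ∃ r : ℝ, r ≠ 0 ∧ unitNormal X q = r • T (X q) := by
  have hne : cross3 (fderiv ℝ X q (1, 0)) (fderiv ℝ X q (0, 1)) ≠ 0 := by
    apply cross3_ne_zero
    rw [LinearIndependent.pair_iff]
    intro x y h
    have h1 : fderiv ℝ X q (x, y) = fderiv ℝ X q 0 := by
      rw [map_zero, ← h, ← map_smul, ← map_smul, ← map_add]; simp
    simpa using hX.immersion q hq h1
  have hN : unitNormal X q ≠ 0 := smul_ne_zero (inv_ne_zero (norm_ne_zero_iff.2 hne)) hne
  have hort : unitNormal X q ∈ (fderiv ℝ X q : ℝ × ℝ →ₗ[ℝ] E3).rangeᗮ := by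
    rw [Submodule.mem_orthogonal']
    rintro _ ⟨⟨x, y⟩, rfl⟩
    have h1 : fderiv ℝ X q (x, y) = x • fderiv ℝ X q (1, 0) + y • fderiv ℝ X q (0, 1) := by
      rw [← map_smul, ← map_smul, ← map_add]; simp
    change inner ℝ _ (fderiv ℝ X q (x, y)) = 0
    rw [h1, unitNormal, inner_smul_left, inner_add_right, inner_smul_right, inner_smul_right,
      inner_cross3_left, inner_cross3_right]
    simp
  rw [range_fderiv_of_quadric hT hS hX hq, Submodule.orthogonal_orthogonal,
    Submodule.mem_span_singleton] at hort
  obtain ⟨r, hr⟩ := hort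
  exact ⟨r, fun h => hN (by rw [← hr, h, zero_smul]), hr.symm⟩

lemma secondForm_of_quadric (hT : (T : E3 →ₗ[ℝ] E3).IsSymmetric)
    (hS : ∀ p ∈ S, inner ℝ (T p) p = 1) (hX : IsLocalParametrization S X U) (hq : q ∈ U) :
    ∃ r : ℝ, r ≠ 0 ∧ ∀ s t, secondForm X q s t =
      r * inner ℝ (T (fderiv ℝ X q s)) (fderiv ℝ X q t) := by
  obtain ⟨r, hr, h⟩ := unitNormal_of_quadric hT hS hX hq
  refine ⟨-r, neg_ne_zero.2 hr, fun s t => ?_⟩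
  rw [secondForm, h, inner_smul_left, inner_fderiv_fderiv_of_quadric hT hS hX hq]
  simp

/-- A symmetric operator with only one eigenvalue on a subspace is scalar there, as a form. -/
lemma inner_eq_of_eigenvalue_unique (hT : (T : E3 →ₗ[ℝ] E3).IsSymmetric) (W : Submodule ℝ E3)
    {l : ℝ} (h : ∀ m : ℝ, ∀ v ∈ W, v ≠ 0 → (∀ w ∈ W, inner ℝ (T v) w = m * inner ℝ v w) → m = l)
    {v w : E3} (hv : v ∈ W) (hw : w ∈ W) : inner ℝ (T v) w = l * inner ℝ v w := by
  -- The compression of `T` to `W` is symmetric, so it has an orthonormal eigenbasis, with all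
  -- eigenvalues equal to `l`.
  let A : W →ₗ[ℝ] W := W.orthogonalProjectionOnto.toLinearMap ∘ₗ (T : E3 →ₗ[ℝ] E3) ∘ₗ W.subtype
  have hin : ∀ x y : W, inner ℝ (A x) y = inner ℝ (T x) (y : E3) := fun x y => by
    simp [A]
  have hA : A.IsSymmetric := fun x y => by
    rw [hin, real_inner_comm (A y) x, hin, real_inner_comm (x : E3) (T y)]
    exact hT _ _
  have hev : ∀ i, hA.eigenvalues rfl i = l := fun i => by
    refine h _ (hA.eigenvectorBasis rfl i) (Subtype.coe_prop _) ?_ ?_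
    · intro h0
      have := (hA.eigenvectorBasis rfl).orthonormal.ne_zero i
      exact this (Subtype.ext h0)
    · intro w hw
      have h1 := hin (hA.eigenvectorBasis rfl i) ⟨w, hw⟩
      rw [hA.apply_eigenvectorBasis rfl i, inner_smul_left] at h1
      simpa using h1.symm
  have hAl : A = l • LinearMap.id := by
    apply (hA.eigenvectorBasis rfl).toBasis.ext
    intro i
    simp [hA.apply_eigenvectorBasis rfl i, hev]
  have h2 := hin ⟨v, hv⟩ ⟨w, hw⟩
  rw [hAl] at h2
  simpa [inner_smul_left] using h2.symm

/-- Removes the chart from umbilicity: the right-hand side involves only `T` and the point. -/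
lemma existsUnique_principalCurvature_iff_of_quadric (hT : (T : E3 →ₗ[ℝ] E3).IsSymmetric)
    (hS : ∀ p ∈ S, inner ℝ (T p) p = 1) (hX : IsLocalParametrization S X U) (hq : q ∈ U) :
    (∃! κ : ℝ, IsPrincipalCurvature X q κ) ↔
      ∃ l : ℝ, ∀ v w : E3, inner ℝ (T (X q)) v = 0 → inner ℝ (T (X q)) w = 0 →
        inner ℝ (T v) w = l * inner ℝ v w := by
  obtain ⟨r, hr, hII⟩ := secondForm_of_quadric hT hS hX hq
  constructor
  · rintro ⟨κ, -, hκ⟩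
    refine ⟨κ / r, fun v w hv hw => ?_⟩
    refine inner_eq_of_eigenvalue_unique hT (ℝ ∙ T (X q))ᗮ ?_
      (Submodule.mem_orthogonal_singleton_iff_inner_right.2 hv)
      (Submodule.mem_orthogonal_singleton_iff_inner_right.2 hw)
    intro m x hx hx0 hm
    obtain ⟨t, rfl⟩ := exists_fderiv_eq_of_quadric hT hS hX hq
      (Submodule.mem_orthogonal_singleton_iff_inner_right.1 hx)
    rw [eq_div_iff hr, mul_comm]
    refine hκ _ ⟨t, fun h => hx0 (by simp [h]), fun s => ?_⟩
    rw [hII, hm _ (Submodule.mem_orthogonal_singleton_iff_inner_right.2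
      (inner_fderiv_eq_zero_of_quadric hT hS hX hq s)), firstForm, mul_assoc]
  · rintro ⟨l, hl⟩
    have key : ∀ s t, secondForm X q s t = r * l * firstForm X q s t := fun s t => by
      rw [hII, hl _ _ (inner_fderiv_eq_zero_of_quadric hT hS hX hq s)
        (inner_fderiv_eq_zero_of_quadric hT hS hX hq t), firstForm, mul_assoc]
    refine ⟨r * l, ⟨(1, 0), by simp, key _⟩, ?_⟩
    rintro κ ⟨t, ht, h⟩
    have h0 : firstForm X q t t ≠ 0 := by
      rw [firstForm, inner_self_ne_zero]
      intro h1
      exact ht (hX.immersion q hq (by rw [h1, map_zero]))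
    exact mul_right_cancel₀ h0 ((h t).symm.trans (key t t))

end Quadric

/-! ### The umbilic condition for a diagonal quadric -/

lemma scalar_on_orthogonal_iff {d : Fin 3 → ℝ} (h0 : 0 < d 0) (h01 : d 0 < d 1) (h12 : d 1 < d 2)
    {p : E3} (hp : inner ℝ (diagMap d p) p = 1) :
    (∃ l : ℝ, ∀ v w : E3, inner ℝ (diagMap d p) v = 0 → inner ℝ (diagMap d p) w = 0 →
        inner ℝ (diagMap d v) w = l * inner ℝ v w) ↔
      p 1 = 0 ∧ (d 1 - d 0) * (d 2 * p 2) ^ 2 = (d 2 - d 1) * (d 0 * p 0) ^ 2 := by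
  simp only [inner_E3, diagMap_apply] at hp ⊢
  constructor
  · rintro ⟨l, hl⟩
    obtain ⟨x, hx⟩ : ∃ x, x = d 0 * p 0 := ⟨_, rfl⟩
    obtain ⟨y, hy⟩ : ∃ y, y = d 1 * p 1 := ⟨_, rfl⟩
    obtain ⟨z, hz⟩ : ∃ z, z = d 2 * p 2 := ⟨_, rfl⟩
    rw [← hx, ← hy, ← hz] at hp hl
    rw [← hx, ← hz]
    -- The test vectors are, up to sign, the cross products of the coordinate axes with the normal
    -- `(x, y, z)`; they span the tangent plane.
    have e00 := hl !₂[0, z, -y] !₂[0, z, -y] (by simp; ring) (by simp; ring)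
    have e11 := hl !₂[-z, 0, x] !₂[-z, 0, x] (by simp; ring) (by simp; ring)
    have e22 := hl !₂[y, -x, 0] !₂[y, -x, 0] (by simp; ring) (by simp; ring)
    have e01 := hl !₂[0, z, -y] !₂[-z, 0, x] (by simp; ring) (by simp; ring)
    have e02 := hl !₂[0, z, -y] !₂[y, -x, 0] (by simp; ring) (by simp; ring)
    have e12 := hl !₂[-z, 0, x] !₂[y, -x, 0] (by simp; ring) (by simp; ring)
    simp at e00 e11 e22 e01 e02 e12
    -- If `y ≠ 0`, then `l` is an extreme entry, `d 0` or `d 2`, and one of the diagonal identities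
    -- becomes a vanishing sum of terms of one sign, not all zero.
    have hy0 : y = 0 := by
      by_contra hne
      have hy2 : 0 < y ^ 2 := by positivity
      have a1 : (d 2 - l) * x = 0 := mul_right_cancel₀ hne (by linarith)
      have a2 : (d 0 - l) * z = 0 := mul_right_cancel₀ hne (by linarith)
      have b0 : (d 1 - l) * z ^ 2 + (d 2 - l) * y ^ 2 = 0 := by linarith
      have b2 : (d 0 - l) * y ^ 2 + (d 1 - l) * x ^ 2 = 0 := by linarith
      rcases eq_or_ne x 0 with hx0 | hx0
      · rw [hx0] at b2
        have : d 0 - l = 0 := by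
          rcases mul_eq_zero.1 (by linarith : (d 0 - l) * y ^ 2 = 0) with h | h
          · exact h
          · exact absurd h hy2.ne'
        have : 0 < (d 2 - l) * y ^ 2 := mul_pos (by linarith) hy2
        have : 0 ≤ (d 1 - l) * z ^ 2 := mul_nonneg (by linarith) (sq_nonneg z)
        linarith
      · have : d 2 - l = 0 := (mul_eq_zero.1 a1).resolve_right hx0
        have : 0 < (l - d 0) * y ^ 2 := mul_pos (by linarith) hy2
        have : 0 ≤ (l - d 1) * x ^ 2 := mul_nonneg (by linarith) (sq_nonneg x)
        linarith
    rw [hy0] at e00 e22 hp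
    have hl1 : d 1 - l = 0 := by
      by_contra hne
      have hz0 : z ^ 2 = 0 := (mul_eq_zero.1 (by linarith : (d 1 - l) * z ^ 2 = 0)).resolve_left hne
      have hx0 : x ^ 2 = 0 := (mul_eq_zero.1 (by linarith : (d 1 - l) * x ^ 2 = 0)).resolve_left hne
      rw [pow_eq_zero_iff two_ne_zero] at hz0 hx0
      rw [hz0, hx0] at hp
      simp at hp
    have hl2 : l = d 1 := by linarith
    rw [hl2] at e11
    exact ⟨(mul_eq_zero.1 (hy.symm.trans hy0)).resolve_left (by linarith), by linarith⟩
  · rintro ⟨h1, h2⟩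
    refine ⟨d 1, fun v w hv hw => ?_⟩
    have hx : d 0 * p 0 ≠ 0 := by
      intro hx
      rw [hx] at h2
      have hz : d 2 * p 2 = 0 := by
        rw [← pow_eq_zero_iff two_ne_zero]
        exact (mul_eq_zero.1 (by linarith :
          (d 1 - d 0) * (d 2 * p 2) ^ 2 = 0)).resolve_left (by linarith)
      rw [hx, hz, h1] at hp
      simp at hp
    rw [h1] at hv hw
    -- After multiplication by `(d 0 * p 0) ^ 2`, tangency eliminates `v 0` and `w 0`.
    refine mul_left_cancel₀ (pow_ne_zero 2 hx) ?_
    have hv' : d 0 * p 0 * v 0 = - (d 2 * p 2 * v 2) := by linarith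
    have hw' : d 0 * p 0 * w 0 = - (d 2 * p 2 * w 2) := by linarith
    have hvw : (d 0 * p 0) ^ 2 * (v 0 * w 0) = (d 2 * p 2) ^ 2 * (v 2 * w 2) := by
      calc _ = (d 0 * p 0 * v 0) * (d 0 * p 0 * w 0) := by ring
        _ = _ := by rw [hv', hw']; ring
    linear_combination (d 0 - d 1) * hvw - v 2 * w 2 * h2

/-! ### The Monge function of the quadric and its expansion -/

/-- The smaller root `w` of `α (x² + y²) + 2 γ x w + δ w² = 2 g w`. -/
noncomputable def mongeRoot (g α γ δ : ℝ) (q : ℝ × ℝ) : ℝ :=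
  ((g - γ * q.1) - √((g - γ * q.1) ^ 2 - α * δ * (q.1 ^ 2 + q.2 ^ 2))) / δ

/-- A domain of smoothness of `mongeRoot`. -/
def mongeDomain (g α γ δ : ℝ) : Set (ℝ × ℝ) :=
  {q | 0 < g - γ * q.1 ∧ 0 < (g - γ * q.1) ^ 2 - α * δ * (q.1 ^ 2 + q.2 ^ 2)}

section MongeRoot

variable {g α γ δ : ℝ}

lemma isOpen_mongeDomain : IsOpen (mongeDomain g α γ δ) :=
  have h1 : IsOpen {q : ℝ × ℝ | 0 < g - γ * q.1} := isOpen_lt continuous_const (by fun_prop)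
  have h2 : IsOpen {q : ℝ × ℝ | 0 < (g - γ * q.1) ^ 2 - α * δ * (q.1 ^ 2 + q.2 ^ 2)} :=
    isOpen_lt continuous_const (by fun_prop)
  h1.inter h2

lemma zero_mem_mongeDomain (hg : 0 < g) : (0 : ℝ × ℝ) ∈ mongeDomain g α γ δ := by
  simp [mongeDomain, hg]

lemma contDiffOn_mongeRoot : ContDiffOn ℝ 4 (mongeRoot g α γ δ) (mongeDomain g α γ δ) := by
  unfold mongeRoot
  refine ContDiffOn.div_const (ContDiffOn.sub (by fun_prop) ?_) _
  exact ContDiffOn.sqrt (by fun_prop) fun q hq => hq.2.ne'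

/-- Completing the square leaves two roots; the strict inequality selects the smaller one. Being an
open condition, it also cuts the graph out of the quadric. -/
lemma mongeRoot_eq_iff (hδ : 0 < δ) {q : ℝ × ℝ} (hq : q ∈ mongeDomain g α γ δ) {w : ℝ} :
    mongeRoot g α γ δ q = w ↔ δ * w < g - γ * q.1 ∧
      α * (q.1 ^ 2 + q.2 ^ 2) + 2 * γ * q.1 * w + δ * w ^ 2 = 2 * g * w := by
  have hs := Real.sqrt_pos.2 hq.2
  have hs2 := Real.sq_sqrt hq.2.le
  rw [mongeRoot, div_eq_iff hδ.ne']
  set s := √((g - γ * q.1) ^ 2 - α * δ * (q.1 ^ 2 + q.2 ^ 2))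
  constructor
  · intro h
    have hsw : s = g - γ * q.1 - w * δ := by linarith
    refine ⟨by linarith, ?_⟩
    rw [hsw] at hs2
    exact mul_left_cancel₀ hδ.ne' (by linarith)
  · rintro ⟨h1, h2⟩
    have h3 : s ^ 2 = (g - γ * q.1 - δ * w) ^ 2 := by
      rw [hs2]; linear_combination (-δ) * h2
    rw [sq_eq_sq₀ hs.le (by linarith)] at h3
    linarith

open Asymptotics in
lemma mongeRoot_isBigO (hg : 0 < g) (hα : 0 < α) (hδ : 0 < δ) :
    (fun q : ℝ × ℝ => mongeRoot g α γ δ q - (α / g / 2 * (q.1 ^ 2 + q.2 ^ 2)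
      + 3 * (γ * α / g ^ 2) / 6 * q.1 ^ 3 + γ * α / g ^ 2 / 2 * (q.1 * q.2 ^ 2)
      + 0 / 6 * q.2 ^ 3)) =O[𝓝 0] (fun q : ℝ × ℝ => ‖q‖ ^ 4) := by
  set h := mongeRoot g α γ δ
  have hU : ∀ᶠ q in 𝓝 (0 : ℝ × ℝ), q ∈ mongeDomain g α γ δ :=
    isOpen_mongeDomain.mem_nhds (zero_mem_mongeDomain hg)
  have h1 : (fun q : ℝ × ℝ => q.1) =O[𝓝 0] (fun q => ‖q‖) :=
    IsBigO.of_bound 1 (.of_forall fun q => by simpa using norm_fst_le q)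
  have h2 : (fun q : ℝ × ℝ => q.2) =O[𝓝 0] (fun q => ‖q‖) :=
    IsBigO.of_bound 1 (.of_forall fun q => by simpa using norm_snd_le q)
  have hρ : (fun q : ℝ × ℝ => q.1 ^ 2 + q.2 ^ 2) =O[𝓝 0] (fun q => ‖q‖ ^ 2) :=
    (h1.pow 2).add (h2.pow 2)
  -- The equation reads `h (2(g - γx) - δh) = α(x² + y²)`, and near `0` the second factor exceeds `g
  -- / 2`.
  have hh : h =O[𝓝 0] (fun q => ‖q‖ ^ 2) := by
    refine IsBigO.trans (IsBigO.of_bound (2 * α / g) ?_) hρ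
    have hg2 : ∀ᶠ q in 𝓝 (0 : ℝ × ℝ), g / 2 < g - γ * q.1 := by
      have hc : Continuous fun q : ℝ × ℝ => g - γ * q.1 := by fun_prop
      exact hc.continuousAt.eventually (lt_mem_nhds (by simp [hg]))
    filter_upwards [hU, hg2] with q hq hq2
    obtain ⟨h3, h4⟩ := (mongeRoot_eq_iff hδ hq).1 (rfl : h q = h q)
    have hρ0 : 0 ≤ q.1 ^ 2 + q.2 ^ 2 := by positivity
    have e : h q * (2 * (g - γ * q.1) - δ * h q) = α * (q.1 ^ 2 + q.2 ^ 2) := by linarith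
    have hpos : g / 2 < 2 * (g - γ * q.1) - δ * h q := by linarith
    rw [Real.norm_eq_abs, Real.norm_eq_abs, abs_of_nonneg hρ0]
    have e2 : |h q| * (2 * (g - γ * q.1) - δ * h q) = α * (q.1 ^ 2 + q.2 ^ 2) := by
      rw [← abs_of_pos (by linarith : 0 < 2 * (g - γ * q.1) - δ * h q), ← abs_mul, e,
        abs_of_nonneg (by positivity)]
    have e3 : |h q| * (g / 2) ≤ α * (q.1 ^ 2 + q.2 ^ 2) :=
      e2 ▸ mul_le_mul_of_nonneg_left hpos.le (abs_nonneg _)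
    rw [div_mul_eq_mul_div, le_div_iff₀ hg]
    linarith
  have hh2 : (fun q => δ * h q ^ 2) =O[𝓝 0] (fun q : ℝ × ℝ => ‖q‖ ^ 4) := by
    simpa [← pow_mul] using (hh.pow 2).const_mul_left δ
  have hle : (fun q : ℝ × ℝ => ‖q‖ ^ 4) =O[𝓝 0] (fun q => ‖q‖ ^ 3) := by
    refine IsBigO.of_bound 1 ?_
    filter_upwards [Metric.ball_mem_nhds (0 : ℝ × ℝ) one_pos] with q hq
    have : ‖q‖ ≤ 1 := (mem_ball_zero_iff.1 hq).le
    simpa using pow_le_pow_of_le_one (norm_nonneg q) this (by norm_num : 3 ≤ 4)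
  have hxh : (fun q : ℝ × ℝ => 2 * γ * (q.1 * h q)) =O[𝓝 0] (fun q => ‖q‖ ^ 3) := by
    refine ((h1.mul hh).const_mul_left (2 * γ)).congr_right fun q => by ring
  -- Substituting `h = (α(x² + y²) + 2γxh + δh²) / (2g)` into its own term `γxh/g` leaves exactly
  -- this remainder plus `δh²/(2g)`.
  have hr : (fun q : ℝ × ℝ => γ / (2 * g ^ 2) * (q.1 * (2 * γ * (q.1 * h q) + δ * h q ^ 2)))
      =O[𝓝 0] (fun q => ‖q‖ ^ 4) :=
    ((h1.mul (hxh.add (hh2.trans hle))).const_mul_left _).congr_right fun q => by ring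
  refine (hr.add (hh2.const_mul_left (1 / (2 * g)))).congr' ?_ .rfl
  filter_upwards [hU] with q hq
  obtain ⟨-, h4⟩ := (mongeRoot_eq_iff hδ hq).1 (rfl : h q = h q)
  field_simp
  linear_combination (6 * γ * q.1 + 6 * g) * h4

end MongeRoot

/-! ### Graphs over a tangent plane -/

section Graph

variable (e : OrthonormalBasis (Fin 3) ℝ E3)

lemma OrthonormalBasis.inner_fin_three (i j : Fin 3) :
    inner ℝ (e i) (e j) = if i = j then (1 : ℝ) else 0 :=
  orthonormal_iff_ite.1 e.orthonormal i j

/-- Projection to the first two frame coordinates inverts the graph map up to a translation, which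
gives both the immersion and the embedding property. -/
lemma isLocalParametrization_graph {S : Set E3} {p : E3} {h : ℝ × ℝ → ℝ} {U : Set (ℝ × ℝ)}
    (hU : IsOpen U) (hh : ContDiffOn ℝ 4 h U)
    (hV : ∃ V : Set E3, IsOpen V ∧
      (fun q : ℝ × ℝ => p + q.1 • e 0 + q.2 • e 1 + h q • e 2) '' U = S ∩ V) :
    IsLocalParametrization S (fun q => p + q.1 • e 0 + q.2 • e 1 + h q • e 2) U := by
  set X : ℝ × ℝ → E3 := fun q => p + q.1 • e 0 + q.2 • e 1 + h q • e 2 with hXdef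
  let P : E3 →L[ℝ] ℝ × ℝ := (innerSL ℝ (e 0)).prod (innerSL ℝ (e 1))
  have hPX : ∀ q, P (X q) = P p + q := fun q => by
    ext <;> simp [P, X, inner_add_right, inner_smul_right, e.inner_fin_three]
  have hcd : ContDiffOn ℝ 4 X U := by
    apply ContDiffOn.add (by fun_prop)
    exact hh.smul contDiffOn_const
  refine ⟨hU, hcd, fun q hq => ?_, ?_, hV⟩
  · have hd : HasFDerivAt X (fderiv ℝ X q) q :=
      ((hcd.contDiffAt (hU.mem_nhds hq)).differentiableAt (by norm_num)).hasFDerivAt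
    have h1 : HasFDerivAt (fun q => P p + q) (P ∘L fderiv ℝ X q) q := by
      have := P.hasFDerivAt.comp q hd
      rwa [show (P ∘ X) = fun q => P p + q from funext hPX] at this
    have h2 := h1.unique ((hasFDerivAt_id q).const_add (P p))
    exact Function.LeftInverse.injective (g := P) fun s => DFunLike.congr_fun h2 s
  · have hc : Continuous fun q : U => X q := continuousOn_iff_continuous_domRestrict.1 hcd.continuousOn
    have hP : Continuous fun y => P y - P p := by fun_prop
    refine .of_comp hc hP ?_
    have : (fun y => P y - P p) ∘ (fun q : U => X q) = Subtype.val := by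
      funext q; simp [hPX]
    rw [this]
    exact .subtypeVal

variable {e}

lemma inner_quadric_frame {T : E3 →L[ℝ] E3} (hT : (T : E3 →ₗ[ℝ] E3).IsSymmetric)
    {p : E3} {g α γ δ : ℝ} (hp : inner ℝ (T p) p = 1) (hTp : T p = -g • e 2)
    (h00 : inner ℝ (T (e 0)) (e 0) = α) (h11 : inner ℝ (T (e 1)) (e 1) = α)
    (h01 : inner ℝ (T (e 0)) (e 1) = 0) (h12 : inner ℝ (T (e 1)) (e 2) = 0)
    (h02 : inner ℝ (T (e 0)) (e 2) = γ) (h22 : inner ℝ (T (e 2)) (e 2) = δ) (u v w : ℝ) :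
    inner ℝ (T (p + u • e 0 + v • e 1 + w • e 2)) (p + u • e 0 + v • e 1 + w • e 2) =
      1 - 2 * g * w + (α * (u ^ 2 + v ^ 2) + 2 * γ * u * w + δ * w ^ 2) := by
  have hs : ∀ x y, inner ℝ (T x) y = inner ℝ (T y) x := fun x y =>
    (hT x y).trans (real_inner_comm _ _)
  have hp0 : ∀ i, inner ℝ (T p) (e i) = if i = 2 then -g else 0 := fun i => by
    rw [hTp, inner_smul_left, e.inner_fin_three]; simp [eq_comm]
  simp only [map_add, map_smul, inner_add_left, inner_add_right, inner_smul_left,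
    inner_smul_right, hs _ p, hp0, hs (e 1) (e 0), hs (e 2) (e 0), hs (e 2) (e 1),
    h00, h11, h01, h12, h02, h22, hp]
  simp
  ring

/-- Equality of the two diagonal entries `α` is umbilicity; `γ`, the coupling of `e 0` with the
normal, is the only source of cubic terms. -/
lemma hasReducedMongeChart_quadric {T : E3 →L[ℝ] E3} (hT : (T : E3 →ₗ[ℝ] E3).IsSymmetric)
    (he : cross3 (e 0) (e 1) = e 2)
    {p : E3} {g α γ δ : ℝ} (hp : inner ℝ (T p) p = 1) (hTp : T p = -g • e 2)
    (h00 : inner ℝ (T (e 0)) (e 0) = α) (h11 : inner ℝ (T (e 1)) (e 1) = α)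
    (h01 : inner ℝ (T (e 0)) (e 1) = 0) (h12 : inner ℝ (T (e 1)) (e 2) = 0)
    (h02 : inner ℝ (T (e 0)) (e 2) = γ) (h22 : inner ℝ (T (e 2)) (e 2) = δ)
    (hg : 0 < g) (hα : 0 < α) (hδ : 0 < δ) :
    HasReducedMongeChart {y | inner ℝ (T y) y = 1} p (α / g) (3 * (γ * α / g ^ 2))
      (γ * α / g ^ 2) 0 := by
  have hq := inner_quadric_frame hT hp hTp h00 h11 h01 h12 h02 h22
  refine ⟨e, mongeRoot g α γ δ, mongeDomain g α γ δ, he, zero_mem_mongeDomain hg,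
    isLocalParametrization_graph e isOpen_mongeDomain contDiffOn_mongeRoot ?_,
    mongeRoot_isBigO hg hα hδ⟩
  let c : Fin 3 → E3 → ℝ := fun i y => inner ℝ (e i) (y - p)
  have hcont : ∀ i, Continuous (c i) := fun i => by fun_prop
  have hc : ∀ u v w : ℝ, c 0 (p + u • e 0 + v • e 1 + w • e 2) = u ∧
      c 1 (p + u • e 0 + v • e 1 + w • e 2) = v ∧
      c 2 (p + u • e 0 + v • e 1 + w • e 2) = w := fun u v w => by
    simp [c, inner_add_right, inner_sub_right, inner_smul_right, e.inner_fin_three]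
  refine ⟨{y | (c 0 y, c 1 y) ∈ mongeDomain g α γ δ} ∩ {y | δ * c 2 y < g - γ * c 0 y},
    (isOpen_mongeDomain.preimage ((hcont 0).prodMk (hcont 1))).inter
      (isOpen_lt (by fun_prop) (by fun_prop)), ?_⟩
  ext y
  constructor
  · rintro ⟨q, hqU, rfl⟩
    obtain ⟨c0, c1, c2⟩ := hc q.1 q.2 (mongeRoot g α γ δ q)
    obtain ⟨r1, r2⟩ := (mongeRoot_eq_iff hδ hqU).1 rfl
    refine ⟨?_, ?_, ?_⟩
    · simp only [Set.mem_ofPred_eq, hq]; linarith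
    · simpa only [Set.mem_ofPred_eq, c0, c1] using hqU
    · simpa only [Set.mem_ofPred_eq, c0, c2] using r1
  · rintro ⟨hy, hyU, hyw⟩
    have hy3 : p + c 0 y • e 0 + c 1 y • e 1 + c 2 y • e 2 = y := by
      have := e.sum_repr' (y - p)
      rw [Fin.sum_univ_three] at this
      rw [add_assoc, add_assoc, ← add_assoc (c 0 y • e 0), this, add_sub_cancel]
    refine ⟨(c 0 y, c 1 y), hyU, ?_⟩
    have hr : mongeRoot g α γ δ (c 0 y, c 1 y) = c 2 y := by
      refine (mongeRoot_eq_iff hδ hyU).2 ⟨hyw, ?_⟩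
      have := hq (c 0 y) (c 1 y) (c 2 y)
      rw [hy3] at this
      have hy' : inner ℝ (T y) y = 1 := hy
      dsimp only
      linarith
    simp only [hr, hy3]

end Graph

/-! ### Umbilic points of diagonal quadrics -/

lemma exists_meridian_frame {m n : ℝ} (h : m ^ 2 + n ^ 2 = 1) :
    ∃ e : OrthonormalBasis (Fin 3) ℝ E3,
      e 0 = !₂[n, 0, -m] ∧ e 1 = !₂[0, 1, 0] ∧ e 2 = !₂[m, 0, n] := by
  have ho : Orthonormal ℝ ![!₂[n, 0, -m], !₂[0, 1, 0], (!₂[m, 0, n] : E3)] := by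
    rw [orthonormal_iff_ite]
    intro i j
    rw [inner_E3]
    fin_cases i <;> fin_cases j <;> simp <;> linarith
  let b := basisOfOrthonormalOfCardEqFinrank ho (by simp)
  have hb : ⇑b = ![!₂[n, 0, -m], !₂[0, 1, 0], (!₂[m, 0, n] : E3)] :=
    coe_basisOfOrthonormalOfCardEqFinrank ho _
  refine ⟨b.toOrthonormalBasis (hb ▸ ho), ?_⟩
  simp [hb]

lemma exists_hasReducedMongeChart_of_meridian {d : Fin 3 → ℝ} (h0 : 0 < d 0) (h01 : d 0 < d 1)
    (h12 : d 1 < d 2) {p : E3} (hp : inner ℝ (diagMap d p) p = 1) (hp1 : p 1 = 0)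
    (hu : (d 1 - d 0) * (d 2 * p 2) ^ 2 = (d 2 - d 1) * (d 0 * p 0) ^ 2) :
    ∃ k B : ℝ, k ≠ 0 ∧ B ≠ 0 ∧
      HasReducedMongeChart {y | inner ℝ (diagMap d y) y = 1} p k (3 * B) B 0 := by
  have hp' := hp
  rw [inner_diagMap, hp1] at hp'
  have hx : d 0 * p 0 ≠ 0 := by
    intro hx
    rw [hx] at hu
    have hz : d 2 * p 2 = 0 := by
      rw [← pow_eq_zero_iff two_ne_zero]
      exact (mul_eq_zero.1 (by linarith :
        (d 1 - d 0) * (d 2 * p 2) ^ 2 = 0)).resolve_left (by linarith)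
    rw [hx, hz] at hp'
    simp at hp'
  have hz : d 2 * p 2 ≠ 0 := by
    intro hz
    rw [hz] at hu
    have := (mul_eq_zero.1 (by linarith :
        (d 2 - d 1) * (d 0 * p 0) ^ 2 = 0)).resolve_left (by linarith)
    exact hx ((pow_eq_zero_iff two_ne_zero).1 this)
  obtain ⟨g, hg, hg2⟩ : ∃ g : ℝ, 0 < g ∧ g ^ 2 = (d 0 * p 0) ^ 2 + (d 2 * p 2) ^ 2 :=
    ⟨√((d 0 * p 0) ^ 2 + (d 2 * p 2) ^ 2), Real.sqrt_pos.2 (by positivity),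
      Real.sq_sqrt (by positivity)⟩
  -- The minus sign makes `(m, 0, n)` the inward normal, so that `T p = -g • e 2` with `g > 0`.
  obtain ⟨m, hm⟩ : ∃ m, d 0 * p 0 = -g * m := ⟨-(d 0 * p 0) / g, by field_simp⟩
  obtain ⟨n, hn⟩ : ∃ n, d 2 * p 2 = -g * n := ⟨-(d 2 * p 2) / g, by field_simp⟩
  rw [hm] at hx
  rw [hn] at hz
  have hm0 : m ≠ 0 := right_ne_zero_of_mul hx
  have hn0 : n ≠ 0 := right_ne_zero_of_mul hz
  rw [hm, hn] at hg2 hu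
  have hmn : m ^ 2 + n ^ 2 = 1 := mul_left_cancel₀ (pow_ne_zero 2 hg.ne') (by linarith)
  -- With `m² + n² = 1` this says `d 0 n² + d 2 m² = d 1`, that is `⟨T e₀, e₀⟩ = ⟨T e₁, e₁⟩`.
  have hu' : (d 1 - d 0) * n ^ 2 = (d 2 - d 1) * m ^ 2 :=
    mul_left_cancel₀ (pow_ne_zero 2 hg.ne') (by linarith)
  obtain ⟨e, e0, e1, e2⟩ := exists_meridian_frame hmn
  have hγ : (d 0 - d 2) * m * n ≠ 0 :=
    mul_ne_zero (mul_ne_zero (by linarith) hm0) hn0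
  have hd1 : 0 < d 1 := h0.trans h01
  have hd2 : 0 < d 2 := hd1.trans h12
  refine ⟨_, _, ?_, ?_, hasReducedMongeChart_quadric (e := e) (g := g) (α := d 1)
    (γ := (d 0 - d 2) * m * n) (δ := d 0 * m ^ 2 + d 2 * n ^ 2) (diagMap_isSymmetric d)
    ?_ hp ?_ ?_ ?_ ?_ ?_ ?_ ?_ hg hd1 (by positivity)⟩
  · positivity
  · exact div_ne_zero (mul_ne_zero hγ hd1.ne') (by positivity)
  · rw [e0, e1, e2]; ext i; fin_cases i <;> simp [cross3, cross_apply]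
  · rw [e2]; ext i; fin_cases i <;> simp [hm, hn, hp1]
  · rw [e0, inner_diagMap]; simp; linear_combination d 1 * hmn - hu'
  · rw [e1, inner_diagMap]; simp
  · rw [e0, e1, inner_diagMap]; simp
  · rw [e1, e2, inner_diagMap]; simp
  · rw [e0, e2, inner_diagMap]; simp; ring
  · rw [e2, inner_diagMap]; simp; ring

lemma isUmbilic_diag_iff {d : Fin 3 → ℝ} (h0 : 0 < d 0) (h01 : d 0 < d 1)
    (h12 : d 1 < d 2) {p : E3} :
    IsUmbilic {y | inner ℝ (diagMap d y) y = 1} p ↔ inner ℝ (diagMap d p) p = 1 ∧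
      p 1 = 0 ∧ (d 1 - d 0) * (d 2 * p 2) ^ 2 = (d 2 - d 1) * (d 0 * p 0) ^ 2 := by
  have hT := diagMap_isSymmetric d
  constructor
  · rintro ⟨X, U, hX, q, hq, rfl, hκ⟩
    have hp : inner ℝ (diagMap d (X q)) (X q) = 1 := hX.mem hq
    exact ⟨hp, (scalar_on_orthogonal_iff h0 h01 h12 hp).1
      ((existsUnique_principalCurvature_iff_of_quadric hT (fun _ h => h) hX hq).1 hκ)⟩
  · rintro ⟨hp, h1, h2⟩
    -- Umbilicity requires some parametrization through `p`; the Monge chart supplies it.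
    obtain ⟨k, B, -, -, e, h, U, -, hU, hX, hO⟩ :=
      exists_hasReducedMongeChart_of_meridian h0 h01 h12 hp h1 h2
    have hX0 : p + (0 : ℝ × ℝ).1 • e 0 + (0 : ℝ × ℝ).2 • e 1 + h 0 • e 2 = p := by
      -- The `O(‖q‖ ^ 4)` bound, read at `q = 0`, forces `h 0 = 0`.
      have := hO.eq_zero_imp.self_of_nhds (by simp)
      simp at this
      simp [this]
    refine ⟨_, U, hX, 0, hU, hX0, ?_⟩
    rw [existsUnique_principalCurvature_iff_of_quadric hT (fun _ h => h) hX hU, hX0]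
    exact (scalar_on_orthogonal_iff h0 h01 h12 hp).2 ⟨h1, h2⟩

/-! ### The ellipsoid -/

lemma ellipsoid_eq (a b c : ℝ) :
    ellipsoid a b c = {y | inner ℝ (diagMap ![1 / a ^ 2, 1 / b ^ 2, 1 / c ^ 2] y) y = 1} := by
  ext y
  rw [ellipsoid, Set.mem_ofPred_eq, Set.mem_ofPred_eq, inner_diagMap]
  simp only [Matrix.cons_val]
  rw [show y 0 ^ 2 / a ^ 2 + y 1 ^ 2 / b ^ 2 + y 2 ^ 2 / c ^ 2 =
    1 / a ^ 2 * y 0 * y 0 + 1 / b ^ 2 * y 1 * y 1 + 1 / c ^ 2 * y 2 * y 2 by ring]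

lemma ncard_signed_pairs {x z : ℝ} (hx : 0 < x) (hz : 0 < z) :
    {p : E3 | p 1 = 0 ∧ p 0 ^ 2 = x ^ 2 ∧ p 2 ^ 2 = z ^ 2}.ncard = 4 := by
  have h : {p : E3 | p 1 = 0 ∧ p 0 ^ 2 = x ^ 2 ∧ p 2 ^ 2 = z ^ 2} =
      {!₂[x, 0, z], !₂[x, 0, -z], !₂[-x, 0, z], !₂[-x, 0, -z]} := by
    ext p
    have hp : ∀ u w : ℝ, p = !₂[u, 0, w] ↔ p 0 = u ∧ p 1 = 0 ∧ p 2 = w := fun u w => by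
      rw [PiLp.ext_iff, Fin.forall_fin_succ, Fin.forall_fin_two]; simp
    simp only [Set.mem_ofPred_eq, Set.mem_insert_iff, Set.mem_singleton_iff, hp, sq_eq_sq_iff_eq_or_eq_neg]
    tauto
  have hne : ∀ u w u' w' : ℝ, (!₂[u, 0, w] : E3) = !₂[u', 0, w'] ↔ u = u' ∧ w = w' := by
    intro u w u' w'
    rw [PiLp.ext_iff, Fin.forall_fin_succ, Fin.forall_fin_two]; simp
  have hx' : x ≠ -x := by linarith
  have hz' : z ≠ -z := by linarith
  rw [h, Set.ncard_insert_of_notMem, Set.ncard_insert_of_notMem, Set.ncard_pair]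
  all_goals simp [hne, hx', hz', hz'.symm]

lemma ellipsoid_weights_lt {a b c : ℝ} (hc : 0 < c) (hbc : c < b) (hab : b < a) :
    0 < 1 / a ^ 2 ∧ 1 / a ^ 2 < 1 / b ^ 2 ∧ 1 / b ^ 2 < 1 / c ^ 2 := by
  have hb := hc.trans hbc
  have ha := hb.trans hab
  exact ⟨by positivity, by gcongr, by gcongr⟩

/-- The umbilic points of an ellipsoid with distinct axes. -/
lemma isUmbilic_ellipsoid_iff {a b c : ℝ} (hc : 0 < c) (hbc : c < b) (hab : b < a) {p : E3} :
    IsUmbilic (ellipsoid a b c) p ↔ p 1 = 0 ∧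
      p 0 ^ 2 = √(a ^ 2 * (a ^ 2 - b ^ 2) / (a ^ 2 - c ^ 2)) ^ 2 ∧
      p 2 ^ 2 = √(c ^ 2 * (b ^ 2 - c ^ 2) / (a ^ 2 - c ^ 2)) ^ 2 := by
  obtain ⟨h0, h01, h12⟩ := ellipsoid_weights_lt hc hbc hab
  have hb := hc.trans hbc
  have ha := hb.trans hab
  have hab2 : 0 < a ^ 2 - b ^ 2 := sub_pos.2 (by gcongr)
  have hbc2 : 0 < b ^ 2 - c ^ 2 := sub_pos.2 (by gcongr)
  have hac2 : 0 < a ^ 2 - c ^ 2 := by linarith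
  rw [ellipsoid_eq, isUmbilic_diag_iff h0 h01 h12, inner_diagMap,
    Real.sq_sqrt (by positivity), Real.sq_sqrt (by positivity)]
  simp only [Matrix.cons_val]
  rw [and_left_comm]
  refine and_congr_right fun h1 => ?_
  rw [h1, eq_div_iff hac2.ne', eq_div_iff hac2.ne']
  have e1 : 1 / a ^ 2 * p 0 * p 0 + 1 / b ^ 2 * 0 * 0 + 1 / c ^ 2 * p 2 * p 2 = 1 ↔
      c ^ 2 * p 0 ^ 2 + a ^ 2 * p 2 ^ 2 = a ^ 2 * c ^ 2 := by
    simp only [mul_zero, add_zero]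
    field_simp
  have e2 : (1 / b ^ 2 - 1 / a ^ 2) * (1 / c ^ 2 * p 2) ^ 2 =
      (1 / c ^ 2 - 1 / b ^ 2) * (1 / a ^ 2 * p 0) ^ 2 ↔
      (a ^ 2 - b ^ 2) * a ^ 2 * p 2 ^ 2 = (b ^ 2 - c ^ 2) * c ^ 2 * p 0 ^ 2 := by
    field_simp
  rw [e1, e2]
  -- Both sides are linear systems in `p 0 ^ 2` and `p 2 ^ 2`; the left one has determinant
  -- `±a²c²(a² - c²) ≠ 0`.
  constructor
  · rintro ⟨h, h'⟩
    constructor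
    · apply mul_left_cancel₀ (pow_ne_zero 2 hc.ne')
      linear_combination (a ^ 2 - b ^ 2) * h - h'
    · apply mul_left_cancel₀ (pow_ne_zero 2 ha.ne')
      linear_combination (b ^ 2 - c ^ 2) * h + h'
  · rintro ⟨h, h'⟩
    constructor
    · apply mul_left_cancel₀ hac2.ne'
      linear_combination c ^ 2 * h + a ^ 2 * h'
    · apply mul_left_cancel₀ hac2.ne'
      linear_combination (a ^ 2 - b ^ 2) * a ^ 2 * h' - (b ^ 2 - c ^ 2) * c ^ 2 * h

theorem proposition8 (a b c : ℝ) (hc : 0 < c) (hbc : c < b) (hab : b < a) :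
    {p : E3 | IsUmbilic (ellipsoid a b c) p}.ncard = 4 ∧
    (∀ p : E3, IsUmbilic (ellipsoid a b c) p → p 1 = 0) ∧
    (∀ p : E3, IsUmbilic (ellipsoid a b c) p →
      IsTypeH1 (ellipsoid a b c) p ∧ IsTypeD1 (ellipsoid a b c) p) := by
  refine ⟨?_, fun p hp => ((isUmbilic_ellipsoid_iff hc hbc hab).1 hp).1, fun p hp => ?_⟩
  · have hb := hc.trans hbc
    have ha := hb.trans hab
    have hab2 : 0 < a ^ 2 - b ^ 2 := sub_pos.2 (by gcongr)
    have hbc2 : 0 < b ^ 2 - c ^ 2 := sub_pos.2 (by gcongr)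
    have hac2 : 0 < a ^ 2 - c ^ 2 := by linarith
    simp only [isUmbilic_ellipsoid_iff hc hbc hab]
    exact ncard_signed_pairs (by positivity) (by positivity)
  · obtain ⟨h0, h01, h12⟩ := ellipsoid_weights_lt hc hbc hab
    obtain ⟨k, B, hk, hB, hchart⟩ : ∃ k B : ℝ, k ≠ 0 ∧ B ≠ 0 ∧
        HasReducedMongeChart (ellipsoid a b c) p k (3 * B) B 0 := by
      rw [ellipsoid_eq] at hp ⊢
      obtain ⟨h1, h2, h3⟩ := (isUmbilic_diag_iff h0 h01 h12).1 hp
      exact exists_hasReducedMongeChart_of_meridian h0 h01 h12 h1 h2 h3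
    have hne : B - 3 * B ≠ 0 := fun h => hB (by linarith)
    have hB4 : 0 < B ^ 4 := by positivity
    refine ⟨⟨hp, k, 3 * B, B, 0, hchart, mul_ne_zero (mul_ne_zero hk hB) hne, ?_⟩,
      ⟨hp, k, 3 * B, B, 0, hchart, mul_ne_zero hB hne, ?_⟩⟩
    -- At `(3B, B, 0)` the discriminants are `48 B⁴` and, in the next goal, `4 B⁴`.
    · ring_nf; linarith
    · ring_nf; linarith
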